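/- Let $n\ge 1$, $T>0$, $A\in\mathbb{R}^{n\times n}$ and $B\in\mathbb{R}^{n\times 1}$, and consider the linear system $\dot x(t)=Ax(t)+Bu(t)$ with scalar control $u$. Assume that the pair $(A,B)$ is controllable and that $A$ is nonsingular. For $\xi\in\mathbb{R}^n$ let $$\mathcal{U}(\xi)=\Bigl\{u\in L^1[0,T]:\ \int_0^T e^{-As}Bu(s)\,ds=-\xi,\ \sup_{t\in[0,T]}|u(t)|\le 1\Bigr\}$$ be the set of controls of magnitude at most $1$ that steer the state from $x(0)=\xi$ to $x(T)=0$. Here controls are integrable functions on $[0,T]$, not equivalence classes. Let $$\mathcal{R}=\Bigl\{\int_0^T e^{-As}Bu(s)\,ds:\ u\in L^1[0,T],\ \sup_{t\in[0,T]}|u(t)|\le 1\Bigr\}\subset\mathbb{R}^n$$ be the reachable set, and let $\|u\|_0$ be the Lebesgue measure of the support of $u$, that is, of the closure of $\{t\in[0,T]:u(t)\ne 0\}$. Then for every $\xi\in\mathcal{R}$ the minimum $$V(\xi)=\min_{u\in\mathcal{U}(\xi)}\|u\|_0$$ is attained, and the value function $V$ is continuous on $\mathcal{R}$. -/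

import Mathlib

open MeasureTheory Set

/-- The vector `e^{tA} B ∈ ℝⁿ`, for `A ∈ ℝ^{n×n}` and a column `B ∈ ℝ^{n×1}`. -/
noncomputable def expCol {n : ℕ} (A : Matrix (Fin n) (Fin n) ℝ) (B : Matrix (Fin n) (Fin 1) ℝ)
    (t : ℝ) : EuclideanSpace ℝ (Fin n) :=
  WithLp.toLp 2 fun i => (NormedSpace.exp (t • A) * B) i 0

/-- The state at time `t` of `ẋ = A x + B u`, `x 0 = x₀`, that is,
`x(t) = e^{tA} x₀ + ∫₀ᵗ e^{(t-s)A} B u(s) ds`. -/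
noncomputable def stateAt {n : ℕ} (A : Matrix (Fin n) (Fin n) ℝ) (B : Matrix (Fin n) (Fin 1) ℝ)
    (x₀ : EuclideanSpace ℝ (Fin n)) (u : ℝ → ℝ) (t : ℝ) : EuclideanSpace ℝ (Fin n) :=
  WithLp.toLp 2 ((NormedSpace.exp (t • A)).mulVec x₀.ofLp) + ∫ s in 0..t, u s • expCol A B (t - s)

/-- `(A, B)` is controllable: every state can be steered to every other state, in some finite
time, by some integrable control. -/
def IsControllable {n : ℕ} (A : Matrix (Fin n) (Fin n) ℝ) (B : Matrix (Fin n) (Fin 1) ℝ) : Prop :=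
  ∀ x₀ x₁ : EuclideanSpace ℝ (Fin n), ∃ τ : ℝ, 0 < τ ∧ ∃ u : ℝ → ℝ,
    IntegrableOn u (Icc 0 τ) ∧ stateAt A B x₀ u τ = x₁

/-- The controls `u ∈ L¹[0,T]` with `‖u‖_∞ = sup_{t ∈ [0,T]} |u t| ≤ 1`.
Values of `u` outside `[0,T]` are irrelevant. -/
def boundedControls (T : ℝ) : Set (ℝ → ℝ) :=
  {u | IntegrableOn u (Icc 0 T) ∧ ∀ t ∈ Icc 0 T, |u t| ≤ 1}

/-- The vector `∫₀ᵀ e^{-As} B u(s) ds`. -/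
noncomputable def controlIntegral {n : ℕ} (A : Matrix (Fin n) (Fin n) ℝ)
    (B : Matrix (Fin n) (Fin 1) ℝ) (T : ℝ) (u : ℝ → ℝ) : EuclideanSpace ℝ (Fin n) :=
  ∫ s in 0..T, u s • expCol A B (-s)

/-- The set `𝓤(ξ)` of admissible controls for the initial state `ξ`. -/
def admissible {n : ℕ} (A : Matrix (Fin n) (Fin n) ℝ) (B : Matrix (Fin n) (Fin 1) ℝ) (T : ℝ)
    (ξ : EuclideanSpace ℝ (Fin n)) : Set (ℝ → ℝ) :=
  {u | u ∈ boundedControls T ∧ controlIntegral A B T u = -ξ}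

/-- The reachable set `𝓡`. -/
def reachable {n : ℕ} (A : Matrix (Fin n) (Fin n) ℝ) (B : Matrix (Fin n) (Fin 1) ℝ) (T : ℝ) :
    Set (EuclideanSpace ℝ (Fin n)) :=
  controlIntegral A B T '' boundedControls T

/-- The `L⁰` norm on `[0,T]`: the Lebesgue measure of the support, which is the closure of
`{t ∈ [0,T] : u t ≠ 0}`. -/
noncomputable def l0norm (T : ℝ) (u : ℝ → ℝ) : ℝ :=
  volume.real (closure {t : ℝ | t ∈ Icc 0 T ∧ u t ≠ 0})

/-- The value function `V(ξ)`, the infimum of the `L⁰` norm over `𝓤(ξ)`. -/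
noncomputable def valueFn {n : ℕ} (A : Matrix (Fin n) (Fin n) ℝ) (B : Matrix (Fin n) (Fin 1) ℝ)
    (T : ℝ) (ξ : EuclideanSpace ℝ (Fin n)) : ℝ :=
  sInf (l0norm T '' admissible A B T ξ)

/-! The `L⁰` problem has the same value as its convex relaxation, the `L¹` problem `minFuel`. Since
`|u| ≤ 1`, fuel never exceeds `l0norm`; equality holds for a control with values in {-1, 0, 1} whose
support gains only a null set under closure.

A functional `(p, c)` supporting the convex set of pairs (state, cost) at an optimal pair reduces
the `L¹` problem to minimizing `q u + c|u|` pointwise, with `q s = ⟪p, e^{-As}B⟫`. The minimizer is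
`switchControl q c`, unique wherever `|q| ≠ c`. Analyticity, controllability and nonsingularity of
`A` make this hold almost everywhere (`IsControllable.ae_inner_expCol_ne`). Near-minimizers are then
`L¹`-close to that control (`exists_dist_switchControl_le`), which gives attainment without weak
compactness.

Continuity: `minFuel` is convex, hence continuous in the interior of the reachable set. Elsewhere `c
= 0`, the optimal control has modulus 1 almost everywhere and costs the maximal `T`, and the same
stability gives lower semicontinuity. -/

/-! ### Nondegeneracy of the switching function -/

open scoped Matrix.Norms.Operator in
/-- The functional `M ↦ ⟪p, M B⟫` on square matrices. -/
noncomputable def pairingMap {n : ℕ} (B : Matrix (Fin n) (Fin 1) ℝ)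
    (p : EuclideanSpace ℝ (Fin n)) : Matrix (Fin n) (Fin n) ℝ →L[ℝ] ℝ :=
  LinearMap.toContinuousLinearMap
    { toFun := fun M => ∑ i, p i * (M * B) i 0
      map_add' := fun M N => by
        simp [Matrix.add_mul, mul_add, Finset.sum_add_distrib]
      map_smul' := fun r M => by
        simp only [Matrix.smul_mul, Matrix.smul_apply, smul_eq_mul, Finset.mul_sum,
          RingHom.id_apply]
        exact Finset.sum_congr rfl fun i _ => by ring }

open scoped Matrix.Norms.Operator in
theorem pairingMap_apply {n : ℕ} (B : Matrix (Fin n) (Fin 1) ℝ)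
    (p : EuclideanSpace ℝ (Fin n)) (M : Matrix (Fin n) (Fin n) ℝ) :
    pairingMap B p M = ∑ i, p i * (M * B) i 0 := rfl

theorem inner_expCol {n : ℕ} (A : Matrix (Fin n) (Fin n) ℝ) (B : Matrix (Fin n) (Fin 1) ℝ)
    (p : EuclideanSpace ℝ (Fin n)) (t : ℝ) :
    inner ℝ p (expCol A B t) = pairingMap B p (NormedSpace.exp (t • A)) := by
  rw [pairingMap_apply, PiLp.inner_apply]
  refine Finset.sum_congr rfl fun i _ => ?_
  simp [expCol, mul_comm]

open scoped Matrix.Norms.Operator in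
theorem analyticOnNhd_inner_expCol_neg {n : ℕ} (A : Matrix (Fin n) (Fin n) ℝ)
    (B : Matrix (Fin n) (Fin 1) ℝ) (p : EuclideanSpace ℝ (Fin n)) :
    AnalyticOnNhd ℝ (fun t => inner ℝ p (expCol A B (-t))) univ := by
  intro t _
  simp only [inner_expCol]
  have h1 : AnalyticAt ℝ (fun t : ℝ => (-t) • A) t := by fun_prop
  have h2 : AnalyticAt ℝ (NormedSpace.exp : Matrix (Fin n) (Fin n) ℝ → _) ((-t) • A) :=
    NormedSpace.exp_analytic _
  exact ((pairingMap B p).analyticAt _).comp (h2.comp_of_eq h1 rfl)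

open scoped Matrix.Norms.Operator in
theorem hasDerivAt_inner_expCol {n : ℕ} (A : Matrix (Fin n) (Fin n) ℝ)
    (B : Matrix (Fin n) (Fin 1) ℝ) (p : EuclideanSpace ℝ (Fin n)) (t : ℝ) :
    HasDerivAt (fun t => inner ℝ p (expCol A B t))
      (inner ℝ (WithLp.toLp 2 (Matrix.vecMul p.ofLp A) : EuclideanSpace ℝ (Fin n)) (expCol A B t)) t := by
  have h := (pairingMap B p).hasFDerivAt.comp_hasDerivAt t
    (hasDerivAt_exp_smul_const' (𝕂 := ℝ) A t)
  have h2 : pairingMap B p (A * NormedSpace.exp (t • A)) =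
      pairingMap B (WithLp.toLp 2 (Matrix.vecMul p.ofLp A)) (NormedSpace.exp (t • A)) := by
    have := Matrix.dotProduct_mulVec p.ofLp A (fun i => (NormedSpace.exp (t • A) * B) i 0)
    rw [pairingMap_apply, pairingMap_apply, Matrix.mul_assoc]
    exact this
  simp only [inner_expCol]
  rw [← h2]
  exact h

theorem continuous_expCol {n : ℕ} (A : Matrix (Fin n) (Fin n) ℝ)
    (B : Matrix (Fin n) (Fin 1) ℝ) : Continuous (expCol A B) := by
  have h : ∀ i, Continuous fun t => expCol A B t i := fun i => by
    have h2 : ∀ t, expCol A B t i =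
        inner ℝ (EuclideanSpace.single i (1 : ℝ)) (expCol A B t) := fun t => by
      simp [EuclideanSpace.inner_single_left]
    simp only [h2]
    exact continuous_iff_continuousAt.2 fun t => (hasDerivAt_inner_expCol A B _ t).continuousAt
  exact (PiLp.continuous_toLp 2 _).comp (continuous_pi h)

/-- Such a `p` is orthogonal to every state reachable from 0, in particular to itself. -/
theorem IsControllable.eq_zero_of_inner_expCol {n : ℕ} {A : Matrix (Fin n) (Fin n) ℝ}
    {B : Matrix (Fin n) (Fin 1) ℝ} (hAB : IsControllable A B) {p : EuclideanSpace ℝ (Fin n)}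
    (hp : ∀ t, inner ℝ p (expCol A B t) = 0) : p = 0 := by
  obtain ⟨τ, hτ, u, hu, hx⟩ := hAB 0 p
  have hint : IntervalIntegrable (fun s => u s • expCol A B (τ - s)) volume 0 τ := by
    refine IntervalIntegrable.smul_continuousOn ?_
      ((continuous_expCol A B).comp (continuous_const.sub continuous_id)).continuousOn
    exact (intervalIntegrable_iff_integrableOn_Icc_of_le hτ.le).2 hu
  simp only [stateAt, WithLp.ofLp_zero, Matrix.mulVec_zero, WithLp.toLp_zero, zero_add] at hx
  have h : inner ℝ p (∫ s in 0..τ, u s • expCol A B (τ - s)) = 0 := by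
    have := (innerSL ℝ p).intervalIntegral_comp_comm hint
    simp only [innerSL_apply_apply] at this
    simp [← this, inner_smul_right, hp]
  rwa [hx, inner_self_eq_zero] at h

/-- A real analytic function that is not identically `c` takes the value `c` only on a null set. If
it is constant, differentiating shows that `pA` annihilates the whole orbit, so `pA = 0` and `p =
0`; the constant is then 0, while `c ≠ 0`. -/
theorem IsControllable.ae_inner_expCol_ne {n : ℕ} {A : Matrix (Fin n) (Fin n) ℝ}
    {B : Matrix (Fin n) (Fin 1) ℝ} (hAB : IsControllable A B) (hA : A.det ≠ 0)
    {p : EuclideanSpace ℝ (Fin n)} {c : ℝ} (hpc : p ≠ 0 ∨ c ≠ 0) :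
    ∀ᵐ t : ℝ, inner ℝ p (expCol A B (-t)) ≠ c := by
  have han : AnalyticOnNhd ℝ (fun t => inner ℝ p (expCol A B (-t)) - c) univ :=
    (analyticOnNhd_inner_expCol_neg A B p).sub analyticOnNhd_const
  by_cases hex : ∃ t, inner ℝ p (expCol A B (-t)) - c ≠ 0
  · obtain ⟨t, ht⟩ := hex
    have h := ae_restrict_le_codiscreteWithin (μ := volume) MeasurableSet.univ
      (han.preimage_zero_mem_codiscrete ht)
    rw [Measure.restrict_univ] at h
    filter_upwards [h] with s hs
    simpa [sub_eq_zero] using hs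
  · push Not at hex
    have hconst : (fun t => inner ℝ p (expCol A B t)) = fun _ => c := funext fun t => by
      have := hex (-t)
      rw [neg_neg] at this
      linarith
    have hp : Matrix.vecMul p.ofLp A = 0 := by
      have := hAB.eq_zero_of_inner_expCol
        (p := WithLp.toLp 2 (Matrix.vecMul p.ofLp A)) fun t =>
          (hasDerivAt_inner_expCol A B p t).unique
            (by rw [hconst]; exact hasDerivAt_const t c)
      simpa using this
    have hp0 : p = 0 := by
      have := Matrix.eq_zero_of_vecMul_eq_zero hA hp
      ext i
      simp [this]
    have hc : c ≠ 0 := hpc.resolve_left (fun h => h hp0)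
    simp [hp0, hc.symm]

/-! ### The `L¹` problem along a curve and its convexity -/

section BangOffBang

open Filter Topology

/-- The state reached at time `T` along the curve `γ` with the control `u`. -/
noncomputable def steer {E : Type*} [NormedAddCommGroup E] [NormedSpace ℝ E] (γ : ℝ → E) (T : ℝ)
    (u : ℝ → ℝ) : E :=
  ∫ s in Icc 0 T, u s • γ s

/-- The `L¹` cost of a control. -/
noncomputable def fuel (T : ℝ) (u : ℝ → ℝ) : ℝ :=
  ∫ s in Icc 0 T, |u s|

/-- The least `L¹` cost of a bounded control steering to `x`. -/
noncomputable def minFuel {E : Type*} [NormedAddCommGroup E] [NormedSpace ℝ E] (γ : ℝ → E) (T : ℝ)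
    (x : E) : ℝ :=
  sInf (fuel T '' {u | u ∈ boundedControls T ∧ steer γ T u = x})

/-- The bang-off-bang control with switching function `q` and threshold `c`. -/
noncomputable def switchControl (q : ℝ → ℝ) (c : ℝ) (s : ℝ) : ℝ :=
  if c < q s then -1 else if c < -q s then 1 else 0

variable {E : Type*} [NormedAddCommGroup E] [InnerProductSpace ℝ E] {γ : ℝ → E} {T : ℝ}
  {u v : ℝ → ℝ} {x p : E} {c : ℝ}

theorem fuel_nonneg (T : ℝ) (u : ℝ → ℝ) : 0 ≤ fuel T u :=
  integral_nonneg fun _ => abs_nonneg _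

theorem bddBelow_fuel (S : Set (ℝ → ℝ)) : BddBelow (fuel T '' S) :=
  ⟨0, by rintro _ ⟨u, -, rfl⟩; exact fuel_nonneg T u⟩

theorem minFuel_steer_le (hu : u ∈ boundedControls T) : minFuel γ T (steer γ T u) ≤ fuel T u :=
  csInf_le (bddBelow_fuel _) ⟨u, ⟨hu, rfl⟩, rfl⟩

theorem exists_fuel_lt (hx : x ∈ steer γ T '' boundedControls T) {ε : ℝ} (hε : 0 < ε) :
    ∃ u ∈ boundedControls T, steer γ T u = x ∧ fuel T u < minFuel γ T x + ε := by
  obtain ⟨v, hv, hvx⟩ := hx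
  have hne : (fuel T '' {u | u ∈ boundedControls T ∧ steer γ T u = x}).Nonempty :=
    ⟨_, v, ⟨hv, hvx⟩, rfl⟩
  obtain ⟨_, ⟨u, hu, rfl⟩, h⟩ :=
    exists_lt_of_csInf_lt hne (lt_add_of_pos_right (minFuel γ T x) hε)
  exact ⟨u, hu.1, hu.2, h⟩

theorem le_minFuel (hx : x ∈ steer γ T '' boundedControls T) {b : ℝ}
    (h : ∀ u ∈ boundedControls T, steer γ T u = x → b ≤ fuel T u) : b ≤ minFuel γ T x := by
  obtain ⟨v, hv, hvx⟩ := hx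
  refine le_csInf ⟨_, v, ⟨hv, hvx⟩, rfl⟩ ?_
  rintro _ ⟨u, hu, rfl⟩
  exact h u hu.1 hu.2

theorem fuel_le (hT : 0 ≤ T) (hu : u ∈ boundedControls T) : fuel T u ≤ T := by
  have h : fuel T u ≤ ∫ _ in Icc 0 T, (1 : ℝ) :=
    setIntegral_mono_on hu.1.abs (by simp) measurableSet_Icc hu.2
  simpa [hT] using h

theorem integrableOn_inner_mul (hγ : Continuous γ) (p : E) (hu : IntegrableOn u (Icc 0 T)) :
    IntegrableOn (fun s => inner ℝ p (γ s) * u s) (Icc 0 T) :=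
  IntegrableOn.continuousOn_mul (by fun_prop) hu isCompact_Icc

theorem integrableOn_smul_curve (hγ : Continuous γ) (hu : IntegrableOn u (Icc 0 T)) :
    IntegrableOn (fun s => u s • γ s) (Icc 0 T) :=
  IntegrableOn.smul_continuousOn hu hγ.continuousOn isCompact_Icc

theorem convex_boundedControls (T : ℝ) : Convex ℝ (boundedControls T) := by
  intro u hu v hv a b ha hb hab
  refine ⟨(hu.1.smul a).add (hv.1.smul b), fun t ht => ?_⟩
  have h1 := hu.2 t ht
  have h2 := hv.2 t ht
  simp only [Pi.add_apply, Pi.smul_apply, smul_eq_mul]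
  calc |a * u t + b * v t| ≤ a * |u t| + b * |v t| := by
        refine (abs_add_le _ _).trans_eq ?_
        rw [abs_mul, abs_mul, abs_of_nonneg ha, abs_of_nonneg hb]
    _ ≤ a * 1 + b * 1 := by gcongr
    _ = 1 := by linarith

theorem fuel_combo_le (hu : u ∈ boundedControls T) (hv : v ∈ boundedControls T) {a b : ℝ}
    (ha : 0 ≤ a) (hb : 0 ≤ b) :
    fuel T (a • u + b • v) ≤ a * fuel T u + b * fuel T v := by
  have h : fuel T (a • u + b • v) ≤ ∫ s in Icc 0 T, (a * |u s| + b * |v s|) := by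
    refine integral_mono ((hu.1.smul a).add (hv.1.smul b)).abs
      ((hu.1.abs.const_mul a).add (hv.1.abs.const_mul b)) fun s => ?_
    refine (abs_add_le _ _).trans_eq ?_
    simp [abs_mul, abs_of_nonneg ha, abs_of_nonneg hb]
  rwa [integral_add (hu.1.abs.const_mul a) (hv.1.abs.const_mul b), integral_const_mul,
    integral_const_mul] at h

theorem neg_mem_boundedControls (hu : u ∈ boundedControls T) : -u ∈ boundedControls T :=
  ⟨hu.1.neg, by simpa using hu.2⟩

theorem steer_combo (hγ : Continuous γ) (hu : u ∈ boundedControls T)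
    (hv : v ∈ boundedControls T) (a b : ℝ) :
    steer γ T (a • u + b • v) = a • steer γ T u + b • steer γ T v := by
  have h1 : IntegrableOn (fun s => a • u s • γ s) (Icc 0 T) :=
    (integrableOn_smul_curve hγ hu.1).smul a
  have h2 : IntegrableOn (fun s => b • v s • γ s) (Icc 0 T) :=
    (integrableOn_smul_curve hγ hv.1).smul b
  rw [steer, steer, steer, ← integral_smul, ← integral_smul, ← integral_add h1 h2]
  simp [add_smul, mul_smul]

theorem steer_neg (γ : ℝ → E) (T : ℝ) (u : ℝ → ℝ) : steer γ T (-u) = -steer γ T u := by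
  simp [steer, integral_neg]

theorem convex_steer_image (hγ : Continuous γ) : Convex ℝ (steer γ T '' boundedControls T) := by
  rintro _ ⟨u, hu, rfl⟩ _ ⟨v, hv, rfl⟩ a b ha hb hab
  exact ⟨_, convex_boundedControls T hu hv ha hb hab, steer_combo hγ hu hv a b⟩

theorem convexOn_minFuel (hγ : Continuous γ) :
    ConvexOn ℝ (steer γ T '' boundedControls T) (minFuel γ T) := by
  refine ⟨convex_steer_image hγ, fun x hx y hy a b ha hb hab => ?_⟩
  refine le_of_forall_pos_le_add fun ε hε => ?_
  obtain ⟨u, hu, rfl, hu'⟩ := exists_fuel_lt hx hε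
  obtain ⟨v, hv, rfl, hv'⟩ := exists_fuel_lt hy hε
  rw [← steer_combo hγ hu hv]
  refine (minFuel_steer_le (convex_boundedControls T hu hv ha hb hab)).trans
    ((fuel_combo_le hu hv ha hb).trans ?_)
  rw [smul_eq_mul, smul_eq_mul]
  calc a * fuel T u + b * fuel T v
      ≤ a * (minFuel γ T (steer γ T u) + ε) + b * (minFuel γ T (steer γ T v) + ε) := by gcongr
    _ = _ := by linear_combination ε * hab

theorem inner_steer [CompleteSpace E] (hγ : Continuous γ) (p : E)
    (hu : IntegrableOn u (Icc 0 T)) :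
    inner ℝ p (steer γ T u) = ∫ s in Icc 0 T, inner ℝ p (γ s) * u s := by
  have h := (innerSL ℝ p).integral_comp_comm (integrableOn_smul_curve hγ hu)
  simp only [innerSL_apply_apply] at h
  rw [steer, ← h]
  simp [inner_smul_right, mul_comm]

/-! ### Bang-off-bang controls and their stability -/

/-- Quantitative pointwise optimality: the excess of `q w + c|w|` over its minimum controls the
distance to the minimizer, with a weight vanishing only where `|q| = c`. -/
theorem switchControl_bound {c : ℝ} (hc : 0 ≤ c) (q : ℝ → ℝ) (s : ℝ) {w : ℝ} (hw : |w| ≤ 1) :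
    |(|q s| - c)| * |w - switchControl q c s| ≤
      q s * w + c * |w| - (q s * switchControl q c s + c * |switchControl q c s|) := by
  obtain ⟨h1, h2⟩ := abs_le.1 hw
  unfold switchControl
  split_ifs with h h'
  · rw [abs_of_nonneg (show 0 ≤ q s by linarith), abs_of_nonneg (show 0 ≤ q s - c by linarith),
      abs_of_nonneg (show 0 ≤ w - -1 by linarith)]
    have := mul_le_mul_of_nonneg_left (neg_abs_le w) hc
    simp only [abs_neg, abs_one]
    nlinarith
  · rw [abs_of_nonpos (show q s ≤ 0 by linarith), abs_of_nonneg (show 0 ≤ -q s - c by linarith),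
      abs_of_nonpos (show w - 1 ≤ 0 by linarith)]
    have := mul_le_mul_of_nonneg_left (le_abs_self w) hc
    simp only [abs_one]
    nlinarith
  · have hq : |q s| ≤ c := abs_le.2 ⟨by linarith, by linarith⟩
    rw [abs_of_nonpos (show |q s| - c ≤ 0 by linarith)]
    have := neg_abs_le (q s * w)
    rw [abs_mul] at this
    simp only [sub_zero, abs_zero, mul_zero, add_zero]
    nlinarith

theorem abs_switchControl {c : ℝ} (hc : 0 ≤ c) (q : ℝ → ℝ) (s : ℝ) :
    |switchControl q c s| = indicator {s | c < |q s|} 1 s := by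
  unfold switchControl
  by_cases h : c < |q s|
  · rw [indicator_of_mem (show s ∈ {s | c < |q s|} from h)]
    rcases lt_abs.1 h with h | h
    · simp [h]
    · simp [h, show ¬ c < q s by linarith]
  · rw [indicator_of_notMem (show s ∉ {s | c < |q s|} from h)]
    rw [lt_abs, not_or] at h
    simp [h.1, h.2]

theorem abs_switchControl_le {c : ℝ} (hc : 0 ≤ c) (q : ℝ → ℝ) (s : ℝ) :
    |switchControl q c s| ≤ 1 := by
  rw [abs_switchControl hc]
  exact indicator_le_self' (fun _ _ => zero_le_one) s

theorem measurable_switchControl {q : ℝ → ℝ} (hq : Measurable q) (c : ℝ) :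
    Measurable (switchControl q c) :=
  Measurable.ite (measurableSet_lt measurable_const hq) measurable_const
    (Measurable.ite (measurableSet_lt measurable_const hq.neg) measurable_const measurable_const)

theorem switchControl_mem_boundedControls {q : ℝ → ℝ} (hq : Measurable q) (hc : 0 ≤ c) :
    switchControl q c ∈ boundedControls T :=
  ⟨Measure.integrableOn_of_bounded (M := 1) (by simp)
    (measurable_switchControl hq c).aestronglyMeasurable
    (Eventually.of_forall fun s => abs_switchControl_le hc q s),
    fun s _ => abs_switchControl_le hc q s⟩

/-- A uniformly bounded function whose integral against an almost everywhere positive weight is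
small has a small integral. -/
theorem exists_integral_abs_le_of_weighted {α : Type*} [MeasurableSpace α] {μ : Measure α}
    [IsFiniteMeasure μ] {g : α → ℝ} (hg : Measurable g) (hpos : ∀ᵐ a ∂μ, 0 < g a) (M : ℝ)
    {ε : ℝ} (hε : 0 < ε) :
    ∃ δ > 0, ∀ f : α → ℝ, Integrable f μ → Integrable (fun a => g a * |f a|) μ →
      (∀ᵐ a ∂μ, |f a| ≤ M) → ∫ a, g a * |f a| ∂μ ≤ δ → ∫ a, |f a| ∂μ ≤ ε := by
  -- The sets where `g < 1/(k+1)` shrink to a null set, so for some `k` they contribute at most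
  -- `ε/2`; off them `1 ≤ (k+1) g`.
  have hlim : Tendsto (fun k : ℕ => ∫ a, indicator {a | g a < 1 / ((k : ℝ) + 1)} (fun _ => M) a ∂μ)
      atTop (𝓝 (∫ _, (0 : ℝ) ∂μ)) := by
    refine tendsto_integral_of_dominated_convergence (fun _ => |M|)
      (fun k => (measurable_const.indicator
        (measurableSet_lt hg measurable_const)).aestronglyMeasurable)
      (integrable_const _) (fun k => Eventually.of_forall fun a => ?_) ?_
    · exact norm_indicator_le_norm_self (fun _ => M) a
    · filter_upwards [hpos] with a ha
      refine tendsto_const_nhds.congr' ?_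
      filter_upwards [(tendsto_one_div_add_atTop_nhds_zero_nat (𝕜 := ℝ)).eventually_lt_const ha]
        with k hk
      rw [indicator_of_notMem (show a ∉ {a | g a < 1 / ((k : ℝ) + 1)} from lt_asymm hk)]
  rw [integral_zero] at hlim
  obtain ⟨k, hk⟩ := (hlim.eventually_lt_const (half_pos hε)).exists
  have hk0 : (0 : ℝ) < k + 1 := by positivity
  refine ⟨ε / 2 / (k + 1), by positivity, fun f hf hgf hM hle => ?_⟩
  have hind : Integrable (indicator {a | g a < 1 / ((k : ℝ) + 1)} fun _ => M) μ :=
    (integrable_const M).indicator (measurableSet_lt hg measurable_const)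
  calc ∫ a, |f a| ∂μ
      ≤ ∫ a, (indicator {a | g a < 1 / ((k : ℝ) + 1)} (fun _ => M) a
          + (k + 1) * (g a * |f a|)) ∂μ := by
        refine integral_mono_ae hf.abs (hind.add (hgf.const_mul _)) ?_
        filter_upwards [hpos, hM] with a ha hMa
        have h0 := abs_nonneg (f a)
        by_cases h : g a < 1 / ((k : ℝ) + 1)
        · rw [indicator_of_mem (show a ∈ {a | g a < 1 / ((k : ℝ) + 1)} from h)]
          have : 0 ≤ ((k : ℝ) + 1) * (g a * |f a|) := by positivity
          linarith
        · rw [indicator_of_notMem (show a ∉ {a | g a < 1 / ((k : ℝ) + 1)} from h)]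
          rw [not_lt, div_le_iff₀ hk0] at h
          nlinarith
    _ = ∫ a, indicator {a | g a < 1 / ((k : ℝ) + 1)} (fun _ => M) a ∂μ
          + (k + 1) * ∫ a, g a * |f a| ∂μ := by
        rw [integral_add hind (hgf.const_mul _), integral_const_mul]
    _ ≤ ε / 2 + (k + 1) * (ε / 2 / (k + 1)) := by gcongr
    _ = ε := by field_simp; ring

theorem exists_dist_switchControl_le [CompleteSpace E] (hγ : Continuous γ) (hc : 0 ≤ c)
    (hne : ∀ᵐ t : ℝ, |inner ℝ p (γ t)| ≠ c) {ε : ℝ} (hε : 0 < ε) :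
    ∃ δ > 0, ∀ u ∈ boundedControls T,
      inner ℝ p (steer γ T u) + c * fuel T u ≤
        inner ℝ p (steer γ T (switchControl (fun s => inner ℝ p (γ s)) c))
          + c * fuel T (switchControl (fun s => inner ℝ p (γ s)) c) + δ →
      ∫ s in Icc 0 T, |u s - switchControl (fun s => inner ℝ p (γ s)) c s| ≤ ε := by
  set q : ℝ → ℝ := fun s => inner ℝ p (γ s) with hq
  have hqc : Continuous q := by fun_prop
  have hw : switchControl q c ∈ boundedControls T :=
    switchControl_mem_boundedControls hqc.measurable hc
  obtain ⟨δ, hδ, h⟩ := exists_integral_abs_le_of_weighted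
    (μ := volume.restrict (Icc 0 T)) (g := fun s => |(|q s| - c)|) (by fun_prop)
    (by
      filter_upwards [ae_restrict_of_ae hne] with s hs
      exact abs_pos.2 (sub_ne_zero.2 hs)) 2 hε
  refine ⟨δ, hδ, fun u hu hle => h _ (hu.1.sub hw.1) ?_ ?_ ?_⟩
  · exact IntegrableOn.continuousOn_mul (by fun_prop) (hu.1.sub hw.1).abs isCompact_Icc
  · filter_upwards [ae_restrict_mem measurableSet_Icc] with s hs
    have h1 := hu.2 s hs
    have h2 := hw.2 s hs
    exact (abs_sub _ _).trans (by linarith)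
  · have i1 := integrableOn_inner_mul hγ p hu.1
    have i2 := integrableOn_inner_mul hγ p hw.1
    have i3 := hu.1.abs.const_mul c
    have i4 := hw.1.abs.const_mul c
    have hmono : ∫ s in Icc 0 T, |(|q s| - c)| * |u s - switchControl q c s| ≤
        ∫ s in Icc 0 T, (q s * u s + c * |u s|
          - (q s * switchControl q c s + c * |switchControl q c s|)) := by
      refine setIntegral_mono_on ?_ ((i1.add i3).sub (i2.add i4)) measurableSet_Icc
        fun s hs => switchControl_bound hc q s (hu.2 s hs)
      exact IntegrableOn.continuousOn_mul (by fun_prop) (hu.1.sub hw.1).abs isCompact_Icc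
    rw [inner_steer hγ p hu.1, inner_steer hγ p hw.1, fuel, fuel] at hle
    have hsplit : ∫ s in Icc 0 T, (q s * u s + c * |u s|
          - (q s * switchControl q c s + c * |switchControl q c s|)) =
        (∫ s in Icc 0 T, q s * u s) + c * (∫ s in Icc 0 T, |u s|) -
        ((∫ s in Icc 0 T, q s * switchControl q c s) +
          c * ∫ s in Icc 0 T, |switchControl q c s|) := by
      have i13 : IntegrableOn (fun s => q s * u s + c * |u s|) (Icc 0 T) := i1.add i3
      have i24 : IntegrableOn (fun s => q s * switchControl q c s + c * |switchControl q c s|)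
        (Icc 0 T) := i2.add i4
      rw [integral_sub i13 i24, integral_add i1 i3, integral_add i2 i4,
        integral_const_mul, integral_const_mul]
    refine hmono.trans ?_
    rw [hsplit]
    linarith

theorem abs_fuel_sub_le (hu : IntegrableOn u (Icc 0 T)) (hv : IntegrableOn v (Icc 0 T)) :
    |fuel T u - fuel T v| ≤ ∫ s in Icc 0 T, |u s - v s| := by
  rw [fuel, fuel, ← integral_sub hu.abs hv.abs]
  refine (abs_integral_le_integral_abs).trans ?_
  exact integral_mono (hu.abs.sub hv.abs).abs (hu.sub hv).abs fun s => abs_abs_sub_abs_le _ _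

theorem exists_norm_steer_sub_le (hγ : Continuous γ) (T : ℝ) :
    ∃ C > 0, ∀ u v, IntegrableOn u (Icc 0 T) → IntegrableOn v (Icc 0 T) →
      ‖steer γ T u - steer γ T v‖ ≤ C * ∫ s in Icc 0 T, |u s - v s| := by
  obtain ⟨C, hC⟩ := (isCompact_Icc (a := 0) (b := T)).exists_bound_of_continuousOn hγ.continuousOn
  refine ⟨max C 1, by positivity, fun u v hu hv => ?_⟩
  have h1 := integrableOn_smul_curve hγ hu
  have h2 := integrableOn_smul_curve hγ hv
  rw [steer, steer, ← integral_sub h1 h2, ← integral_const_mul]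
  refine (norm_integral_le_integral_norm _).trans ?_
  refine setIntegral_mono_on (h1.sub h2).norm ((hu.sub hv).abs.const_mul _) measurableSet_Icc
    fun s hs => ?_
  rw [← sub_smul, norm_smul, Real.norm_eq_abs, mul_comm]
  exact mul_le_mul_of_nonneg_right ((hC s hs).trans (le_max_left _ _)) (abs_nonneg _)

theorem ae_abs_inner_ne
    (hγne : ∀ (p : E) (c : ℝ), p ≠ 0 ∨ c ≠ 0 → ∀ᵐ t : ℝ, inner ℝ p (γ t) ≠ c)
    (hpc : p ≠ 0 ∨ c ≠ 0) : ∀ᵐ t : ℝ, |inner ℝ p (γ t)| ≠ c := by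
  filter_upwards [hγne p c hpc, hγne p (-c) (by simpa using hpc)] with t h1 h2 h
  rcases eq_or_eq_neg_of_abs_eq h with h | h
  exacts [h1 h, h2 h]

end BangOffBang

/-! ### Supporting functionals, optimality and continuity -/

section ValueFunction

open Filter Topology

variable {E : Type*} [NormedAddCommGroup E] [InnerProductSpace ℝ E] [FiniteDimensional ℝ E]
  {γ : ℝ → E} {T : ℝ} {u : ℝ → ℝ} {x p : E} {c : ℝ}

/-- If the interior is empty, the set lies in a proper affine subspace, and any normal to it works.
-/
theorem Convex.exists_ne_zero_inner_le {s : Set E} (hs : Convex ℝ s) (hx : x ∈ s)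
    (hxi : x ∉ interior s) : ∃ p : E, p ≠ 0 ∧ ∀ y ∈ s, inner ℝ p x ≤ inner ℝ p y := by
  by_cases hint : (interior s).Nonempty
  · obtain ⟨f, hf, hle⟩ := geometric_hahn_banach_of_nonempty_interior_point hs hxi hint
    refine ⟨-(InnerProductSpace.toDual ℝ E).symm f, by simpa using hf, fun y hy => ?_⟩
    simpa using hle y hy
  · rw [hs.interior_nonempty_iff_affineSpan_eq_top,
      AffineSubspace.affineSpan_eq_top_iff_vectorSpan_eq_top_of_nonempty ℝ E E ⟨x, hx⟩] at hint
    obtain ⟨p, hp, hp0⟩ := Submodule.exists_mem_ne_zero_of_ne_bot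
      (mt (Submodule.orthogonal_eq_bot_iff (K := vectorSpan ℝ s)).1 hint)
    refine ⟨p, hp0, fun y hy => ?_⟩
    have h := Submodule.inner_left_of_mem_orthogonal (vsub_mem_vectorSpan ℝ hy hx) hp
    rw [vsub_eq_sub, inner_sub_right] at h
    linarith

theorem exists_supporting_functional (hγ : Continuous γ) (hT : 0 ≤ T)
    (hx : x ∈ steer γ T '' boundedControls T) :
    ∃ (p : E) (c : ℝ), (p ≠ 0 ∨ c ≠ 0) ∧ 0 ≤ c ∧
      (x ∉ interior (steer γ T '' boundedControls T) → c = 0) ∧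
      ∀ u ∈ boundedControls T,
        inner ℝ p x + c * minFuel γ T x ≤ inner ℝ p (steer γ T u) + c * fuel T u := by
  by_cases hxi : x ∈ interior (steer γ T '' boundedControls T)
  swap
  · obtain ⟨p, hp, h⟩ := (convex_steer_image hγ).exists_ne_zero_inner_le hx hxi
    refine ⟨p, 0, Or.inl hp, le_rfl, fun _ => rfl, fun u hu => ?_⟩
    simpa using h _ ⟨u, hu, rfl⟩
  set C : Set (E × ℝ) := {z | ∃ u ∈ boundedControls T, steer γ T u = z.1 ∧ fuel T u ≤ z.2} with hC
  have hCconv : Convex ℝ C := by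
    rintro ⟨_, r⟩ ⟨u, hu, rfl, hur⟩ ⟨_, r'⟩ ⟨v, hv, rfl, hvr⟩ a b ha hb hab
    refine ⟨a • u + b • v, convex_boundedControls T hu hv ha hb hab, steer_combo hγ hu hv a b,
      (fuel_combo_le hu hv ha hb).trans ?_⟩
    have h1 := mul_le_mul_of_nonneg_left hur ha
    have h2 := mul_le_mul_of_nonneg_left hvr hb
    simpa using add_le_add h1 h2
  -- No bounded control costs more than `T`, so above that level `C` contains a full cylinder over
  -- the reachable set.
  have hxT : (x, T + 1) ∈ interior C := by
    refine mem_interior.2 ⟨interior (steer γ T '' boundedControls T) ×ˢ Ioi T, ?_,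
      isOpen_interior.prod isOpen_Ioi, ⟨hxi, lt_add_one T⟩⟩
    rintro ⟨y, r⟩ ⟨hy, hr⟩
    obtain ⟨u, hu, huy⟩ := interior_subset hy
    exact ⟨u, hu, huy, (fuel_le hT hu).trans (le_of_lt hr)⟩
  have hxm : (x, minFuel γ T x) ∉ interior C := fun h => by
    have h1 : ∀ᶠ r in 𝓝 (minFuel γ T x), (x, r) ∈ C :=
      (Continuous.prodMk_right x).continuousAt.eventually (mem_interior_iff_mem_nhds.1 h)
    obtain ⟨r, ⟨u, hu, hux, hur⟩, hr⟩ :=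
      ((h1.filter_mono nhdsWithin_le_nhds).and
        (self_mem_nhdsWithin (s := Iio (minFuel γ T x)))).exists
    simp only at hux
    subst hux
    exact absurd (minFuel_steer_le (γ := γ) hu) (not_le.2 (hur.trans_lt hr))
  obtain ⟨f, hf, hle⟩ :=
    geometric_hahn_banach_of_nonempty_interior_point hCconv hxm ⟨_, hxT⟩
  have hsplit : ∀ y r, f (y, r) = f (y, 0) + r * f (0, 1) := fun y r => by
    rw [← smul_eq_mul, ← map_smul, ← map_add]
    simp
  have hinner : ∀ y, inner ℝ (-(InnerProductSpace.toDual ℝ E).symm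
      (f.comp (ContinuousLinearMap.inl ℝ E ℝ))) y = -f (y, 0) := fun y => by simp
  refine ⟨-(InnerProductSpace.toDual ℝ E).symm (f.comp (ContinuousLinearMap.inl ℝ E ℝ)),
    -f (0, 1), ?_, ?_, fun h => absurd hxi h, fun u hu => ?_⟩
  · by_contra! h
    refine hf (ContinuousLinearMap.ext fun ⟨y, r⟩ => ?_)
    have hy := hinner y
    rw [h.1, inner_zero_left] at hy
    rw [hsplit, neg_eq_zero.1 hy.symm, neg_eq_zero.1 h.2]
    simp
  -- `C` contains a point strictly above `(x, minFuel γ T x)`, which fixes the sign of the cost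
  -- component.
  · have h := hle _ (interior_subset hxT)
    rw [hsplit, hsplit x (minFuel γ T x)] at h
    have hm : minFuel γ T x ≤ T := by
      obtain ⟨u, hu, rfl⟩ := hx
      exact (minFuel_steer_le hu).trans (fuel_le hT hu)
    nlinarith
  · have h := hle (steer γ T u, fuel T u) ⟨u, hu, rfl, le_rfl⟩
    rw [hsplit, hsplit x (minFuel γ T x)] at h
    rw [hinner, hinner]
    linarith

theorem fuel_switchControl_eq {q : ℝ → ℝ} (hq : Measurable q) (hc : 0 ≤ c) :
    fuel T (switchControl q c) = volume.real ({s | c < |q s|} ∩ Icc 0 T) := by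
  have hm : MeasurableSet {s | c < |q s|} := measurableSet_lt measurable_const (by fun_prop)
  simp only [fuel, abs_switchControl hc]
  rw [integral_indicator_one hm, measureReal_restrict_apply hm]

/-- Closing the support adds at most points with `|q| = c`, a null set. -/
theorem l0norm_switchControl_le {q : ℝ → ℝ} (hq : Continuous q) (hc : 0 ≤ c)
    (hne : ∀ᵐ t : ℝ, |q t| ≠ c) : l0norm T (switchControl q c) ≤ fuel T (switchControl q c) := by
  rw [fuel_switchControl_eq hq.measurable hc]
  have hsub : closure {t | t ∈ Icc 0 T ∧ switchControl q c t ≠ 0} ⊆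
      {s | c ≤ |q s|} ∩ Icc 0 T := by
    refine closure_minimal (fun s hs => ⟨?_, hs.1⟩)
      ((isClosed_le continuous_const hq.abs).inter isClosed_Icc)
    by_contra h
    have h' := abs_switchControl hc q s
    rw [indicator_of_notMem (show s ∉ {s | c < |q s|} from fun h2 => h (show c ≤ |q s| from le_of_lt h2))] at h'
    exact hs.2 (abs_eq_zero.1 h')
  refine (measureReal_mono hsub ?_).trans_eq (measureReal_congr ?_)
  · exact measure_ne_top_of_subset inter_subset_right (by simp)
  · filter_upwards [hne] with s hs
    exact propext (and_congr_left' (show c ≤ |q s| ↔ c < |q s| from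
      ⟨fun h => lt_of_le_of_ne h hs.symm, le_of_lt⟩))

theorem fuel_le_l0norm (hu : u ∈ boundedControls T) : fuel T u ≤ l0norm T u := by
  set K := closure {t : ℝ | t ∈ Icc 0 T ∧ u t ≠ 0} with hK
  have hKm : MeasurableSet K := isClosed_closure.measurableSet
  have hKsub : K ⊆ Icc 0 T := closure_minimal (fun s hs => hs.1) isClosed_Icc
  have h : fuel T u ≤ ∫ s in Icc 0 T, indicator K (1 : ℝ → ℝ) s := by
    refine setIntegral_mono_on hu.1.abs ((integrable_const 1).indicator hKm) measurableSet_Icc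
      fun s hs => ?_
    by_cases h0 : u s = 0
    · rw [h0, abs_zero]
      exact indicator_nonneg (fun _ _ => zero_le_one) s
    · rw [indicator_of_mem (show s ∈ K from subset_closure ⟨hs, h0⟩)]
      exact hu.2 s hs
  rwa [integral_indicator_one hKm, measureReal_restrict_apply hKm,
    inter_eq_self_of_subset_left hKsub] at h

theorem exists_switchControl_optimal (hγ : Continuous γ)
    (hγne : ∀ (p : E) (c : ℝ), p ≠ 0 ∨ c ≠ 0 → ∀ᵐ t : ℝ, inner ℝ p (γ t) ≠ c) (hT : 0 ≤ T)
    (hx : x ∈ steer γ T '' boundedControls T) :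
    ∃ (p : E) (c : ℝ), (p ≠ 0 ∨ c ≠ 0) ∧ 0 ≤ c ∧
      (x ∉ interior (steer γ T '' boundedControls T) → c = 0) ∧
      steer γ T (switchControl (fun s => inner ℝ p (γ s)) c) = x ∧
      fuel T (switchControl (fun s => inner ℝ p (γ s)) c) = minFuel γ T x := by
  obtain ⟨p, c, hpc, hc, hxc, hsup⟩ := exists_supporting_functional hγ hT hx
  refine ⟨p, c, hpc, hc, hxc, ?_⟩
  set w := switchControl (fun s => inner ℝ p (γ s)) c with hw
  have hwb : w ∈ boundedControls T :=
    switchControl_mem_boundedControls (Continuous.measurable (by fun_prop)) hc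
  have happrox : ∀ ε > 0, ∃ u ∈ boundedControls T, steer γ T u = x ∧
      fuel T u < minFuel γ T x + ε ∧ ∫ s in Icc 0 T, |u s - w s| ≤ ε := by
    intro ε hε
    obtain ⟨δ, hδ, h⟩ :=
      exists_dist_switchControl_le (T := T) hγ hc (ae_abs_inner_ne hγne hpc) hε
    obtain ⟨u, hu, hux, huf⟩ :=
      -- Dividing by `c + 1` rather than `c` also covers `c = 0`.
      exists_fuel_lt hx (lt_min hε (show 0 < δ / (c + 1) by positivity))
    refine ⟨u, hu, hux, huf.trans_le (by gcongr; exact min_le_left _ _), h u hu ?_⟩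
    have h1 : c * fuel T u ≤ c * (minFuel γ T x + δ / (c + 1)) :=
      mul_le_mul_of_nonneg_left (huf.le.trans (by gcongr; exact min_le_right _ _)) hc
    have h2 : c * (δ / (c + 1)) ≤ δ := by
      rw [mul_div_assoc', div_le_iff₀ (by positivity)]
      nlinarith
    have h3 := hsup w hwb
    rw [hux]
    linarith
  have hsteer : steer γ T w = x := by
    obtain ⟨C, hC, hle⟩ := exists_norm_steer_sub_le hγ T
    rw [eq_comm, ← sub_eq_zero, ← norm_le_zero_iff]
    refine le_of_forall_pos_le_add fun ε hε => ?_
    obtain ⟨u, hu, rfl, -, h⟩ := happrox (ε / C) (by positivity)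
    calc ‖steer γ T u - steer γ T w‖ ≤ C * (ε / C) :=
          (hle u w hu.1 hwb.1).trans (by gcongr)
      _ = 0 + ε := by field_simp; ring
  refine ⟨hsteer, le_antisymm ?_ (by rw [← hsteer]; exact minFuel_steer_le hwb)⟩
  refine le_of_forall_pos_le_add fun ε hε => ?_
  obtain ⟨u, hu, -, huf, h⟩ := happrox (ε / 2) (by positivity)
  have := (abs_le.1 ((abs_fuel_sub_le hu.1 hwb.1).trans h)).1
  linarith

theorem isLeast_l0norm_minFuel (hγ : Continuous γ)
    (hγne : ∀ (p : E) (c : ℝ), p ≠ 0 ∨ c ≠ 0 → ∀ᵐ t : ℝ, inner ℝ p (γ t) ≠ c) (hT : 0 ≤ T)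
    (hx : x ∈ steer γ T '' boundedControls T) :
    IsLeast (l0norm T '' {u | u ∈ boundedControls T ∧ steer γ T u = x}) (minFuel γ T x) := by
  obtain ⟨p, c, hpc, hc, -, hsteer, hfuel⟩ := exists_switchControl_optimal hγ hγne hT hx
  have hq : Continuous fun s => inner ℝ p (γ s) := by fun_prop
  have hwb : switchControl (fun s => inner ℝ p (γ s)) c ∈ boundedControls T :=
    switchControl_mem_boundedControls hq.measurable hc
  refine ⟨⟨_, ⟨hwb, hsteer⟩, ?_⟩, ?_⟩
  · rw [← hfuel]
    exact le_antisymm (l0norm_switchControl_le hq hc (ae_abs_inner_ne hγne hpc))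
      (fuel_le_l0norm hwb)
  · rintro _ ⟨u, ⟨hu, rfl⟩, rfl⟩
    exact (minFuel_steer_le hu).trans (fuel_le_l0norm hu)

theorem continuousOn_minFuel (hγ : Continuous γ)
    (hγne : ∀ (p : E) (c : ℝ), p ≠ 0 ∨ c ≠ 0 → ∀ᵐ t : ℝ, inner ℝ p (γ t) ≠ c) (hT : 0 ≤ T) :
    ContinuousOn (minFuel γ T) (steer γ T '' boundedControls T) := by
  intro x hx
  by_cases hxi : x ∈ interior (steer γ T '' boundedControls T)
  · exact ((convexOn_minFuel hγ).continuousOn_interior.continuousAt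
      (isOpen_interior.mem_nhds hxi)).continuousWithinAt
  obtain ⟨p, c, hpc, hc, hxc, hsteer, hfuel⟩ := exists_switchControl_optimal hγ hγne hT hx
  obtain rfl := hxc hxi
  have hne := ae_abs_inner_ne hγne hpc
  set w := switchControl (fun s => inner ℝ p (γ s)) 0 with hw
  have hwb : w ∈ boundedControls T :=
    switchControl_mem_boundedControls (Continuous.measurable (by fun_prop)) le_rfl
  -- With `c = 0` the control is off only where `q = 0`, a null set.
  have hwT : fuel T w = T := by
    rw [hw, fuel_switchControl_eq (Continuous.measurable (by fun_prop)) le_rfl]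
    have h : ({s | 0 < |inner ℝ p (γ s)|} ∩ Icc 0 T : Set ℝ) =ᵐ[volume] Icc 0 T := by
      filter_upwards [hne] with s hs
      exact propext (and_iff_right ((abs_nonneg _).lt_of_ne hs.symm))
    rw [measureReal_congr h]
    simp [hT]
  have hub : ∀ y ∈ steer γ T '' boundedControls T, minFuel γ T y ≤ T := by
    rintro _ ⟨u, hu, rfl⟩
    exact (minFuel_steer_le hu).trans (fuel_le hT hu)
  rw [ContinuousWithinAt, ← hfuel, hwT]
  refine tendsto_order.2 ⟨fun a ha => ?_, fun a ha => ?_⟩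
  -- For `y` near `x`, `⟪p, y⟫` is nearly minimal, so every control reaching `y` is `L¹`-close to
  -- `w` and costs nearly `T`.
  · obtain ⟨δ, hδ, h⟩ := exists_dist_switchControl_le (T := T) hγ le_rfl hne
      (half_pos (sub_pos.2 ha))
    have hev : ∀ᶠ y in 𝓝 x, inner ℝ p y < inner ℝ p x + δ :=
      (Continuous.tendsto (f := fun y => inner ℝ p y) (by fun_prop) x).eventually_lt_const
        (lt_add_of_pos_right _ hδ)
    filter_upwards [nhdsWithin_le_nhds hev, self_mem_nhdsWithin] with y hy hyR
    refine lt_of_lt_of_le (show a < T - (T - a) / 2 by linarith) (le_minFuel hyR ?_)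
    rintro u hu rfl
    have h1 := h u hu (by rw [← hw, hsteer]; linarith)
    have h2 := (abs_le.1 ((abs_fuel_sub_le hu.1 hwb.1).trans h1)).1
    rw [hwT] at h2
    linarith
  · filter_upwards [self_mem_nhdsWithin] with y hy
    exact (hub y hy).trans_lt ha

end ValueFunction

/-! ### Return to the linear system -/

theorem controlIntegral_eq_steer {n : ℕ} (A : Matrix (Fin n) (Fin n) ℝ)
    (B : Matrix (Fin n) (Fin 1) ℝ) {T : ℝ} (hT : 0 ≤ T) :
    controlIntegral A B T = steer (fun s => expCol A B (-s)) T := by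
  funext u
  rw [controlIntegral, steer, intervalIntegral.integral_of_le hT, integral_Icc_eq_integral_Ioc]

/-- Needed because `admissible` prescribes the integral `-ξ`, so `V(ξ)` is `minFuel` at `-ξ`. -/
theorem neg_mem_reachable {n : ℕ} {A : Matrix (Fin n) (Fin n) ℝ} {B : Matrix (Fin n) (Fin 1) ℝ}
    {T : ℝ} (hT : 0 ≤ T) {ξ : EuclideanSpace ℝ (Fin n)} (hξ : ξ ∈ reachable A B T) :
    -ξ ∈ reachable A B T := by
  obtain ⟨u, hu, rfl⟩ := hξ
  refine ⟨-u, neg_mem_boundedControls hu, ?_⟩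
  rw [controlIntegral_eq_steer A B hT, steer_neg]

theorem theorem1 {n : ℕ} (A : Matrix (Fin n) (Fin n) ℝ) (B : Matrix (Fin n) (Fin 1) ℝ)
    (hAB : IsControllable A B) (hA : A.det ≠ 0) (T : ℝ) (hT : 0 < T) :
    (∀ ξ ∈ reachable A B T, IsLeast (l0norm T '' admissible A B T ξ) (valueFn A B T ξ)) ∧
      ContinuousOn (valueFn A B T) (reachable A B T) := by
  have hγ : Continuous fun s => expCol A B (-s) := (continuous_expCol A B).comp continuous_neg
  have hγne : ∀ (p : EuclideanSpace ℝ (Fin n)) (c : ℝ), p ≠ 0 ∨ c ≠ 0 →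
      ∀ᵐ t : ℝ, inner ℝ p (expCol A B (-t)) ≠ c := fun p c => hAB.ae_inner_expCol_ne hA
  have hR : reachable A B T = steer (fun s => expCol A B (-s)) T '' boundedControls T := by
    rw [reachable, controlIntegral_eq_steer A B hT.le]
  have hleast : ∀ ξ ∈ reachable A B T, IsLeast (l0norm T '' admissible A B T ξ)
      (minFuel (fun s => expCol A B (-s)) T (-ξ)) := fun ξ hξ => by
    have h := isLeast_l0norm_minFuel hγ hγne hT.le (hR ▸ neg_mem_reachable hT.le hξ)
    rwa [admissible, controlIntegral_eq_steer A B hT.le]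
  have hval : ∀ ξ ∈ reachable A B T,
      valueFn A B T ξ = minFuel (fun s => expCol A B (-s)) T (-ξ) :=
    fun ξ hξ => (hleast ξ hξ).csInf_eq
  refine ⟨fun ξ hξ => hval ξ hξ ▸ hleast ξ hξ, ContinuousOn.congr ?_ hval⟩
  exact (continuousOn_minFuel hγ hγne hT.le).comp continuous_neg.continuousOn
    fun ξ hξ => hR ▸ neg_mem_reachable hT.le hξ
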